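/- All Hilbert spaces are finite-dimensional, $d_S$ denotes the dimension of a system $S$, logarithms are to base 2, and a quantum operation is a completely positive trace-preserving (CPTP) map, i.e. a map $\rho\mapsto\sum_k E_k\rho E_k^\dagger$ with $\sum_k E_k^\dagger E_k=\mathsf{id}$. The conditional min-entropy of a state $\rho_{AB}$ is $$H_{\min}(A|B)_\rho=-\inf_{\sigma_B}\ \inf\{\lambda\in\mathbb{R}:\rho_{AB}\le 2^{\lambda}\,\mathsf{id}_A\otimes\sigma_B\},$$ with $\sigma_B$ ranging over the density operators on $B$ (and $\inf\emptyset=+\infty$). Fix an orthonormal basis $\{|a\rangle\}$ of $A_0$. A cq-state with $A_0$ classical is a state $\sum_a p_a|a\rangle\langle a|\otimes\rho^a$ with $p$ a probability distribution and $\rho^a$ density operators. A quantum operation $\Gamma:L(A_0\otimes S)\to L(A_0\otimes S')$ is classically controlled by $A_0$ if there are CPTP maps $\Gamma^a:L(S)\to L(S')$ such that $\Gamma(\sum_a p_a|a\rangle\langle a|\otimes\rho^a)=\sum_a p_a|a\rangle\langle a|\otimes\Gamma^a(\rho^a)$ for all cq-states. Let $r\ge 1$. An $(r,m_A,m_B)$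 two-party quantum protocol in which Alice's operations are classically controlled by $A_0$ consists of memory spaces $A_1,\dots,A_r$ (Alice) and $B_1,\dots,B_r$ (Bob), an input space $B_0$ for Bob, message spaces $X_1,\dots,X_r$ (Alice to Bob) and $Y_1,\dots,Y_{r-1}$ (Bob to Alice), quantum operations $\Phi_1:L(A_0)\to L(A_0\otimes A_1\otimes X_1)$ and $\Phi_i:L(A_0\otimes A_{i-1}\otimes Y_{i-1})\to L(A_0\otimes A_i\otimes X_i)$ for $2\le i\le r$, all classically controlled by $A_0$, and arbitrary quantum operations $\Psi_j:L(B_{j-1}\otimes X_j)\to L(B_j\otimes Y_j)$ for $1\le j\le r-1$ and $\Psi_r:L(B_{r-1}\otimes X_r)\to L(B_r)$; here $m_A=\sum_{i=1}^r\log d_{X_i}$ and $m_B=\sum_{j=1}^{r-1}\log d_{Y_j}$. The operations are applied in the order $\Phi_1,\Psi_1,\Phi_2,\Psi_2,\dots,\Phi_r,\Psi_r$, each tensored with the identity on the other systems. Theorem (interactive leakage chain rule for quantum min-entropy). Let $\rho_{A_0B_0}$ be a cq-state with $A_0$ classical, let such a protocol be run on $\rho_{A_0B_0}$, and let $\sigma_{A_0A_rB_r}$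 be the final state. Then $$H_{\min}(A_0|B_r)_\sigma\ \ge\ H_{\min}(A_0|B_0)_\rho-\min\{m_A+m_B,\ 2m_A\},$$ where $H_{\min}(A_0|B_r)_\sigma$ is evaluated on the reduced state $\sigma_{A_0B_r}=\mathrm{tr}_{A_r}\,\sigma_{A_0A_rB_r}$. -/

import Mathlib

open scoped Kronecker ComplexOrder

noncomputable section

namespace QLeak

/-- `L(α)`: linear operators on the finite-dimensional Hilbert space with orthonormal basis
`{|i⟩ : i ∈ α}`, written as matrices. The tensor product of two spaces has basis `α × β`. -/
abbrev Op (α : Type) : Type := Matrix α α ℂ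

/-- Density operators: positive semidefinite with unit trace. -/
def IsDensity {α : Type} [Fintype α] (ρ : Op α) : Prop :=
  ρ.PosSemidef ∧ ρ.trace = 1

/-- The projector `|a⟩⟨a|`. -/
def ketbra {α : Type} [DecidableEq α] (a : α) : Op α := Matrix.single a a 1

/-- Probability distributions on a finite set. -/
def IsProb {α : Type} [Fintype α] (p : α → ℝ) : Prop :=
  (∀ a, 0 ≤ p a) ∧ ∑ a, p a = 1

/-- Quantum operations (CPTP maps): `Φ(ρ) = ∑ₖ Eₖ ρ Eₖ†` with `∑ₖ Eₖ† Eₖ = id`. -/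
def IsCPTP {α β : Type} [Fintype α] [DecidableEq α] [Fintype β]
    (Φ : Op α →ₗ[ℂ] Op β) : Prop :=
  ∃ (m : ℕ) (E : Fin m → Matrix β α ℂ),
    (∑ k, (E k).conjTranspose * E k = 1) ∧
      ∀ ρ : Op α, Φ ρ = ∑ k, E k * ρ * (E k).conjTranspose

/-- The operator `∑ₐ pₐ |a⟩⟨a| ⊗ ρᵃ`. -/
def cqOp {α β : Type} [Fintype α] [DecidableEq α] (p : α → ℝ) (ρ : α → Op β) : Op (α × β) :=
  ∑ a, p a • (ketbra a ⊗ₖ ρ a)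

/-- cq-states on `α ⊗ β`, with `α` classical. -/
def IsCQState {α β : Type} [Fintype α] [DecidableEq α] [Fintype β] (ρ : Op (α × β)) : Prop :=
  ∃ (p : α → ℝ) (τ : α → Op β), IsProb p ∧ (∀ a, IsDensity (τ a)) ∧ ρ = cqOp p τ

/-- A quantum operation `Γ : L(α ⊗ β) → L(α ⊗ γ)` that is controlled by the classical system `α`:
on cq-states, `Γ (∑ₐ pₐ |a⟩⟨a| ⊗ ρᵃ) = ∑ₐ pₐ |a⟩⟨a| ⊗ Γᵃ(ρᵃ)` with CPTP maps `Γᵃ`. -/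
def IsControlled {α β γ : Type} [Fintype α] [DecidableEq α] [Fintype β] [DecidableEq β]
    [Fintype γ] (Γ : Op (α × β) →ₗ[ℂ] Op (α × γ)) : Prop :=
  IsCPTP Γ ∧ ∃ G : α → (Op β →ₗ[ℂ] Op γ), (∀ a, IsCPTP (G a)) ∧
    ∀ (p : α → ℝ) (ρ : α → Op β), IsProb p → (∀ a, IsDensity (ρ a)) →
      Γ (cqOp p ρ) = cqOp p fun a => G a (ρ a)

/-- The case of `IsControlled` in which the input consists of the classical system alone:
`Γ : L(α) → L(α ⊗ γ)` with `Γ (∑ₐ pₐ |a⟩⟨a|) = ∑ₐ pₐ |a⟩⟨a| ⊗ τᵃ` for density operators `τᵃ`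
(a CPTP map from a one-dimensional system is the choice of a density operator). -/
def IsControlledPrep {α γ : Type} [Fintype α] [DecidableEq α] [Fintype γ]
    (Γ : Op α →ₗ[ℂ] Op (α × γ)) : Prop :=
  IsCPTP Γ ∧ ∃ τ : α → Op γ, (∀ a, IsDensity (τ a)) ∧
    ∀ p : α → ℝ, IsProb p → Γ (∑ a, p a • ketbra a) = cqOp p τ

/-- `(Φ ⊗ id_γ)(M)`. -/
def tensorId {α β : Type} (γ : Type) (Φ : Op α →ₗ[ℂ] Op β) (M : Op (α × γ)) : Op (β × γ) :=
  Matrix.of fun i j => Φ (Matrix.of fun a a' => M (a, i.2) (a', j.2)) i.1 j.1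

/-- `(id_γ ⊗ Φ)(M)`. -/
def idTensor {α β : Type} (γ : Type) (Φ : Op α →ₗ[ℂ] Op β) (M : Op (γ × α)) : Op (γ × β) :=
  Matrix.of fun i j => Φ (Matrix.of fun a a' => M (i.1, a) (j.1, a')) i.2 j.2

/-- Handing the register `x` over: the systems `(a₀, a, x), b` regrouped as `(a₀, a), (b, x)`. -/
def handOver (α₀ α ξ β : Type) : (α₀ × α × ξ) × β ≃ (α₀ × α) × (β × ξ) where
  toFun s := ((s.1.1, s.1.2.1), (s.2, s.1.2.2))
  invFun t := ((t.1.1, t.1.2, t.2.2), t.2.1)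
  left_inv _ := rfl
  right_inv _ := rfl

/-- A two-party quantum protocol with `r = n + 1` rounds in which Alice's operations are
classically controlled by her input `A₀`, which is preserved.

In one-based numbering, `A k` is Alice's memory `A_{k+1}`, `X k` and `Y k` are the messages
`X_{k+1}` and `Y_{k+1}`, `B k` is Bob's input space `B_0` (for `k = 0`) or memory `B_k`, and `Bout`
is his last memory `B_r`. Likewise `Φ₁` is Alice's first operation, `Φ k` is her operation
`Φ_{k+2}`, `Ψ k` is Bob's operation `Ψ_{k+1}` and `Ψlast` is his last operation `Ψ_r`. Only
`A k`, `X k`, `B k` with `k ≤ n` and `Y k`, `Φ k`, `Ψ k` with `k < n` matter. -/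
structure Protocol (A₀ : Type) [Fintype A₀] [DecidableEq A₀] (n : ℕ) where
  A : ℕ → Type
  X : ℕ → Type
  Y : ℕ → Type
  B : ℕ → Type
  Bout : Type
  [fintypeA : ∀ k, Fintype (A k)]
  [fintypeX : ∀ k, Fintype (X k)]
  [fintypeY : ∀ k, Fintype (Y k)]
  [fintypeB : ∀ k, Fintype (B k)]
  [fintypeBout : Fintype Bout]
  [decEqA : ∀ k, DecidableEq (A k)]
  [decEqX : ∀ k, DecidableEq (X k)]
  [decEqY : ∀ k, DecidableEq (Y k)]
  [decEqB : ∀ k, DecidableEq (B k)]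
  [decEqBout : DecidableEq Bout]
  Φ₁ : Op A₀ →ₗ[ℂ] Op (A₀ × A 0 × X 0)
  Φ : ∀ k, Op (A₀ × A k × Y k) →ₗ[ℂ] Op (A₀ × A (k + 1) × X (k + 1))
  Ψ : ∀ k, Op (B k × X k) →ₗ[ℂ] Op (B (k + 1) × Y k)
  Ψlast : Op (B n × X n) →ₗ[ℂ] Op Bout
  controlled_Φ₁ : IsControlledPrep Φ₁
  controlled_Φ : ∀ k < n, IsControlled (Φ k)
  cptp_Ψ : ∀ k < n, IsCPTP (Ψ k)
  cptp_Ψlast : IsCPTP Ψlast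

attribute [instance] Protocol.fintypeA Protocol.fintypeX Protocol.fintypeY Protocol.fintypeB
  Protocol.fintypeBout Protocol.decEqA Protocol.decEqX Protocol.decEqY Protocol.decEqB
  Protocol.decEqBout

namespace Protocol

variable {A₀ : Type} [Fintype A₀] [DecidableEq A₀] {n : ℕ} (P : Protocol A₀ n)

/-- Qubits sent from Alice to Bob: `m_A = ∑_{i=1}^{r} log₂ d_{X_i}`. -/
def mA : ℝ := ∑ k ∈ Finset.range (n + 1), Real.logb 2 (Fintype.card (P.X k))

/-- Qubits sent from Bob to Alice: `m_B = ∑_{j=1}^{r-1} log₂ d_{Y_j}`. -/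
def mB : ℝ := ∑ k ∈ Finset.range n, Real.logb 2 (Fintype.card (P.Y k))

/-- The global state once Alice has applied her first `k + 1` operations and Bob his first `k`. -/
def stateAfter (ρ : Op (A₀ × P.B 0)) : ∀ k, Op ((A₀ × P.A k × P.X k) × P.B k)
  | 0 => tensorId (P.B 0) P.Φ₁ ρ
  | k + 1 =>
    tensorId (P.B (k + 1)) (P.Φ k)
      (Matrix.reindex (handOver A₀ (P.A k) (P.Y k) (P.B (k + 1))).symm
        (handOver A₀ (P.A k) (P.Y k) (P.B (k + 1))).symm
        (idTensor (A₀ × P.A k) (P.Ψ k)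
          (Matrix.reindex (handOver A₀ (P.A k) (P.X k) (P.B k))
            (handOver A₀ (P.A k) (P.X k) (P.B k)) (stateAfter ρ k))))

/-- The final state `σ_{A₀ A_r B_r}` of the protocol on input `ρ_{A₀ B₀}`. -/
def finalState (ρ : Op (A₀ × P.B 0)) : Op ((A₀ × P.A n) × P.Bout) :=
  idTensor (A₀ × P.A n) P.Ψlast
    (Matrix.reindex (handOver A₀ (P.A n) (P.X n) (P.B n))
      (handOver A₀ (P.A n) (P.X n) (P.B n)) (P.stateAfter ρ n))

end Protocol

/-- Partial trace over the middle system of `(α ⊗ γ) ⊗ β`. -/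
def traceMid {α β γ : Type} [Fintype γ] (M : Op ((α × γ) × β)) : Op (α × β) :=
  Matrix.of fun i j => ∑ c, M ((i.1, c), i.2) ((j.1, c), j.2)

/-- Conditional min-entropy `H_min(A|B)_ρ = - inf_σ inf {l ∈ ℝ : ρ_AB ≤ 2^l id_A ⊗ σ_B}`, with `σ`
ranging over the density operators on `B`. The infima are taken in the extended reals because the
inner set is empty for some `σ`. -/
def Hmin {α β : Type} [DecidableEq α] [Fintype β] (ρ : Op (α × β)) : EReal :=
  -(⨅ (σ : Op β) (_ : IsDensity σ),
    ⨅ (l : ℝ) (_ : (((2 : ℝ) ^ l) • ((1 : Op α) ⊗ₖ σ) - ρ).PosSemidef), (l : EReal))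

end QLeak

end

/-!
Conditioned on Alice's input `a`, the global state is a link product of an operator `Cᵃ` that
describes Alice's side of the interaction and an operator describing Bob's side, contracted along
the messages exchanged so far. If `ρ ≤ 2 ^ l • id ⊗ σ`, replacing Bob's conditional inputs by
`2 ^ l • σ` turns Bob's side into one operator `D` that dominates for all `a` at once. Passing a
message `X` to Bob multiplies `tr D` by `d_X`, so in the end `tr D = ∏ d_X * 2 ^ l`. On Alice's side
the marginal of `Cᵃ` on the messages is at most its trace times the identity, and this trace gains a
factor `d_Y` with each message from Bob; the marginal is also at most `∏ d_X` times the identity,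
because `T ≤ d_X • tr_X T ⊗ id_X` whenever Alice sends `X`. Hence Bob's final conditional states are
dominated by a common operator of trace at most `min (∏ d_Y) (∏ d_X) * ∏ d_X * 2 ^ l`, which is
`2 ^ (l + min (m_A + m_B) (2 * m_A))`.
-/

noncomputable section

namespace QLeak

open Matrix
open scoped MatrixOrder

section PartialTrace

variable {α β : Type}

/-- Partial trace over the left factor. -/
def traceLeft [Fintype α] (M : Op (α × β)) : Op β :=
  ∑ a, M.submatrix (Prod.mk a) (Prod.mk a)

/-- Partial trace over the right factor. -/
def traceRight [Fintype β] (M : Op (α × β)) : Op α :=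
  ∑ b, M.submatrix (·, b) (·, b)

theorem submatrix_mono (e : β → α) : Monotone fun M : Op α => M.submatrix e e :=
  fun _ _ h => PosSemidef.submatrix h e

theorem trace_submatrix_equiv [Fintype α] [Fintype β] (M : Op α) (e : β ≃ α) :
    (M.submatrix e e).trace = M.trace :=
  Equiv.sum_comp e fun i => M i i

theorem traceLeft_apply [Fintype α] (M : Op (α × β)) (i j : β) :
    traceLeft M i j = ∑ a, M (a, i) (a, j) := by
  simp [traceLeft, Matrix.sum_apply]

theorem traceRight_apply [Fintype β] (M : Op (α × β)) (i j : α) :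
    traceRight M i j = ∑ b, M (i, b) (j, b) := by
  simp [traceRight, Matrix.sum_apply]

theorem trace_traceLeft [Fintype α] [Fintype β] (M : Op (α × β)) :
    (traceLeft M).trace = M.trace := by
  simp only [trace, diag_apply, traceLeft_apply, Fintype.sum_prod_type_right]

theorem traceLeft_posSemidef [Fintype α] {M : Op (α × β)} (hM : M.PosSemidef) :
    (traceLeft M).PosSemidef :=
  posSemidef_sum _ fun _ _ => hM.submatrix _

theorem traceLeft_mono [Fintype α] : Monotone (traceLeft : Op (α × β) → Op β) :=
  fun _ _ h => Finset.sum_le_sum fun _ _ => submatrix_mono _ h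

theorem monotone_of_map_posSemidef {f : Op α → Op β} (hsub : ∀ M N, f (M - N) = f M - f N)
    (hpos : ∀ M, M.PosSemidef → (f M).PosSemidef) : Monotone f := by
  intro M N h
  rw [Matrix.le_iff, ← hsub]
  exact hpos _ h

theorem kronecker_mono_right [Finite α] [Finite β] {A : Op α} (hA : A.PosSemidef) :
    Monotone fun B : Op β => A ⊗ₖ B :=
  monotone_of_map_posSemidef (map_sub (kroneckerBilinear (R := ℂ) A)) fun _ => hA.kronecker

theorem kronecker_mono_left [Finite α] [Finite β] {B : Op β} (hB : B.PosSemidef) :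
    Monotone fun A : Op α => A ⊗ₖ B :=
  monotone_of_map_posSemidef (map_sub ((kroneckerBilinear (R := ℂ)).flip B))
    fun _ hA => hA.kronecker hB

theorem le_trace_re_smul_one [Fintype α] [DecidableEq α] {M : Op α} (hM : M.PosSemidef) :
    M ≤ M.trace.re • (1 : Op α) := by
  rw [← Algebra.algebraMap_eq_smul_one]
  refine le_algebraMap_of_spectrum_le (fun x hx => ?_) hM.1
  obtain ⟨i, rfl⟩ := hM.1.spectrum_real_eq_range_eigenvalues ▸ hx
  rw [hM.1.trace_eq_sum_eigenvalues, Complex.re_sum]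
  exact Finset.single_le_sum (f := hM.1.eigenvalues) (fun j _ => hM.eigenvalues_nonneg j)
    (Finset.mem_univ i)

end PartialTrace

section Link

variable {α β ξ η : Type}

/-- The unnormalised maximally entangled vector `∑ₓ |xx⟩`. -/
def entangledVec (ξ : Type) [DecidableEq ξ] : ξ × ξ → ℂ :=
  fun i => if i.1 = i.2 then 1 else 0

/-- The unnormalised maximally entangled operator `∑ₓᵧ |xx⟩⟨yy|`. -/
def entangled (ξ : Type) [DecidableEq ξ] : Op (ξ × ξ) :=
  vecMulVec (entangledVec ξ) (star (entangledVec ξ))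

theorem entangled_apply [DecidableEq ξ] (i j : ξ × ξ) :
    entangled ξ i j = (if i.1 = i.2 then 1 else 0) * (if j.1 = j.2 then 1 else 0) := by
  simp only [entangled, entangledVec, vecMulVec_apply, Pi.star_apply]
  congr 1
  split_ifs <;> simp

theorem entangled_posSemidef [Finite ξ] [DecidableEq ξ] : (entangled ξ).PosSemidef :=
  posSemidef_vecMulVec_self_star _

theorem trace_entangled [Fintype ξ] [DecidableEq ξ] :
    (entangled ξ).trace = Fintype.card ξ := by
  simp [trace, entangled_apply, Fintype.sum_prod_type]

/-- Contraction of an operator on `α ⊗ η` with one on `η ⊗ β` along the shared factor `η`: the link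
product of quantum combs, without the customary partial transposition on `η`. -/
def link [Fintype η] (C : Op (α × η)) (D : Op (η × β)) : Op (α × β) :=
  Matrix.of fun i j => ∑ h, ∑ h', C (i.1, h) (j.1, h') * D (h, i.2) (h', j.2)

theorem link_apply [Fintype η] (C : Op (α × η)) (D : Op (η × β)) (i j : α × β) :
    link C D i j = ∑ h, ∑ h', C (i.1, h) (j.1, h') * D (h, i.2) (h', j.2) :=
  rfl

theorem link_swap [Fintype η] (C : Op (α × η)) (D : Op (η × β)) :
    (link C D).submatrix Prod.swap Prod.swap =
      link (D.submatrix Prod.swap Prod.swap) (C.submatrix Prod.swap Prod.swap) := by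
  ext i j
  simp [link_apply, mul_comm]

-- Compressing `C ⊗ D` by `1 ⊗ (∑ₕ |hh⟩) ⊗ 1` identifies the two copies of `η`.
theorem link_posSemidef [Finite α] [Finite β] [Fintype η] {C : Op (α × η)} {D : Op (η × β)}
    (hC : C.PosSemidef) (hD : D.PosSemidef) : (link C D).PosSemidef := by
  classical
  cases nonempty_fintype α
  cases nonempty_fintype β
  let V : Matrix ((α × η) × (η × β)) (α × β) ℂ := Matrix.of fun s i =>
    if s.1.1 = i.1 ∧ s.2.2 = i.2 ∧ s.1.2 = s.2.1 then 1 else 0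
  have h : link C D = Vᴴ * (C ⊗ₖ D) * V := by
    ext i j
    rw [link_apply, Finset.sum_comm]
    simp [V, Matrix.mul_apply, Fintype.sum_prod_type, ite_and, apply_ite]
  rw [h]
  exact (hC.kronecker hD).conjTranspose_mul_mul_same V

theorem link_mono_right [Finite α] [Finite β] [Fintype η] {C : Op (α × η)} (hC : C.PosSemidef) :
    Monotone (link C : Op (η × β) → Op (α × β)) :=
  monotone_of_map_posSemidef
    (fun D D' => by ext i j; simp [link_apply, mul_sub, Finset.sum_sub_distrib])
    fun _ => link_posSemidef hC

theorem link_mono_left [Finite α] [Finite β] [Fintype η] {D : Op (η × β)} (hD : D.PosSemidef) :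
    Monotone fun C : Op (α × η) => link C D :=
  monotone_of_map_posSemidef
    (fun C C' => by ext i j; simp [link_apply, sub_mul, Finset.sum_sub_distrib])
    fun _ hC => link_posSemidef hC hD

theorem link_smul_right [Fintype η] (c : ℝ) (C : Op (α × η)) (D : Op (η × β)) :
    link C (c • D) = c • link C D := by
  ext i j
  simp [link_apply, Finset.mul_sum, mul_left_comm]

theorem link_one_right [DecidableEq β] [Fintype η] [DecidableEq η] (C : Op (α × η)) :
    link C (1 : Op (η × β)) = traceRight C ⊗ₖ (1 : Op β) := by
  ext i j
  by_cases h : i.2 = j.2 <;> simp [link_apply, traceRight_apply, Matrix.one_apply, h]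

theorem link_entangled [Fintype ξ] [DecidableEq ξ] (T : Op (β × ξ)) : link T (entangled ξ) = T := by
  ext i j
  simp [link_apply, entangled_apply]

theorem traceLeft_link [Fintype α] [Fintype η] (C : Op (α × η)) (D : Op (η × β)) :
    traceLeft (link C D) =
      (link ((traceLeft C).submatrix Prod.snd Prod.snd : Op (Unit × η)) D).submatrix
        (Prod.mk ()) (Prod.mk ()) := by
  ext i j
  simp only [traceLeft_apply, link_apply, submatrix_apply, Finset.sum_mul]
  rw [Finset.sum_comm]
  exact Finset.sum_congr rfl fun _ _ => Finset.sum_comm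

theorem traceLeft_link_le [Fintype α] [Finite β] [Fintype η] [DecidableEq η] {C : Op (α × η)}
    {D : Op (η × β)} {c : ℝ} (hC : traceLeft C ≤ c • 1) (hD : D.PosSemidef) :
    traceLeft (link C D) ≤ c • traceLeft D := by
  have h := link_mono_left hD (submatrix_mono (Prod.snd : Unit × η → η) hC)
  rw [traceLeft_link]
  refine (submatrix_mono (Prod.mk ()) h).trans_eq ?_
  ext i j
  simp [traceLeft_apply, link_apply, Matrix.one_apply, Finset.mul_sum]

theorem le_card_smul_traceRight_kronecker_one [Finite β] [Fintype ξ] [DecidableEq ξ]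
    {T : Op (β × ξ)} (hT : T.PosSemidef) :
    T ≤ (Fintype.card ξ : ℝ) • (traceRight T ⊗ₖ (1 : Op ξ)) :=
  calc
    T = link T (entangled ξ) := (link_entangled T).symm
    _ ≤ link T ((entangled ξ).trace.re • 1) :=
      link_mono_right hT (le_trace_re_smul_one entangled_posSemidef)
    _ = (Fintype.card ξ : ℝ) • (traceRight T ⊗ₖ (1 : Op ξ)) := by
      rw [link_smul_right, link_one_right, trace_entangled, Complex.natCast_re]

/-- Regrouping of `(a, x), b` as `a, (b, x)`: the register `x` moves from the left party to the
right party. -/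
def passEquiv (α ξ β : Type) : (α × ξ) × β ≃ α × (β × ξ) where
  toFun s := (s.1.1, (s.2, s.1.2))
  invFun t := ((t.1, t.2.2), t.2.1)
  left_inv _ := rfl
  right_inv _ := rfl

/-- The operator on `α ⊗ (β ⊗ ξ)` obtained when the left party hands `ξ` to the right party. -/
def passRight (M : Op ((α × ξ) × β)) : Op (α × (β × ξ)) :=
  M.submatrix (passEquiv α ξ β).symm (passEquiv α ξ β).symm

/-- The operator on `(α ⊗ ξ) ⊗ β` obtained when the right party hands `ξ` to the left party. -/
def passLeft (M : Op (α × (β × ξ))) : Op ((α × ξ) × β) :=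
  M.submatrix (passEquiv α ξ β) (passEquiv α ξ β)

/-- The operator on `(α ⊗ ξ) ⊗ (β ⊗ ξ)` in which the two parties share, next to `M`, the
unnormalised maximally entangled operator on `ξ ⊗ ξ`. -/
def share (ξ : Type) [DecidableEq ξ] (M : Op (α × β)) : Op ((α × ξ) × (β × ξ)) :=
  (M ⊗ₖ entangled ξ).submatrix (Equiv.prodProdProdComm α ξ β ξ) (Equiv.prodProdProdComm α ξ β ξ)

theorem share_apply [DecidableEq ξ] (M : Op (α × β)) (i j : (α × ξ) × (β × ξ)) :
    share ξ M i j = M (i.1.1, i.2.1) (j.1.1, j.2.1) *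
      ((if i.1.2 = i.2.2 then 1 else 0) * (if j.1.2 = j.2.2 then 1 else 0)) := by
  rw [← entangled_apply (i.1.2, i.2.2) (j.1.2, j.2.2)]
  rfl

theorem share_posSemidef [Finite α] [Finite β] [Finite ξ] [DecidableEq ξ] {M : Op (α × β)}
    (hM : M.PosSemidef) : (share ξ M).PosSemidef :=
  (hM.kronecker entangled_posSemidef).submatrix _

theorem trace_share [Fintype α] [Fintype β] [Fintype ξ] [DecidableEq ξ] (M : Op (α × β)) :
    (share ξ M).trace = Fintype.card ξ * M.trace := by
  rw [share, trace_submatrix_equiv, trace_kronecker, trace_entangled, mul_comm]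

theorem traceLeft_share [Fintype α] [Fintype ξ] [DecidableEq ξ] (M : Op (α × β)) :
    traceLeft (share ξ M) = traceLeft M ⊗ₖ (1 : Op ξ) := by
  ext i j
  rcases eq_or_ne i.2 j.2 with h | h
  · simp [traceLeft_apply, share_apply, Fintype.sum_prod_type, Matrix.one_apply, h]
  · simp [traceLeft_apply, share_apply, Fintype.sum_prod_type, h, h.symm]

theorem traceLeft_passRight_le [Fintype α] [Finite η] [Fintype ξ] [DecidableEq η] [DecidableEq ξ]
    {C : Op ((α × ξ) × η)} {c : ℝ} (hC : C.PosSemidef) (h : traceLeft C ≤ c • 1) :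
    traceLeft (passRight C) ≤ (Fintype.card ξ * c) • (1 : Op (η × ξ)) :=
  calc
    traceLeft (passRight C)
      ≤ (Fintype.card ξ : ℝ) • (traceRight (traceLeft (passRight C)) ⊗ₖ (1 : Op ξ)) :=
      le_card_smul_traceRight_kronecker_one (traceLeft_posSemidef (hC.submatrix _))
    _ = (Fintype.card ξ : ℝ) • (traceLeft C ⊗ₖ (1 : Op ξ)) := by
      congr 2
      ext i j
      simp only [traceRight_apply, traceLeft_apply, Fintype.sum_prod_type]
      exact Finset.sum_comm
    _ ≤ (Fintype.card ξ : ℝ) • ((c • 1) ⊗ₖ (1 : Op ξ)) := by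
      cases nonempty_fintype η
      gcongr
      exact kronecker_mono_left PosSemidef.one h
    _ = (Fintype.card ξ * c) • (1 : Op (η × ξ)) := by
      rw [smul_kronecker, one_kronecker_one, smul_smul]

theorem passRight_link [Fintype η] [Fintype ξ] [DecidableEq ξ] (C : Op ((α × ξ) × η))
    (D : Op (η × β)) : passRight (link C D) = link (passRight C) (share ξ D) := by
  ext i j
  simp [passRight, passEquiv, link_apply, share_apply, Fintype.sum_prod_type]

theorem passLeft_link [Fintype η] [Fintype ξ] [DecidableEq ξ] (C : Op (α × η))
    (D : Op (η × (β × ξ))) : passLeft (link C D) = link (share ξ C) (passLeft D) := by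
  ext i j
  simp [passLeft, passEquiv, link_apply, share_apply, Fintype.sum_prod_type]

end Link

section Channels

variable {α β γ η : Type}

theorem tensorId_sub (Φ : Op α →ₗ[ℂ] Op β) (M N : Op (α × γ)) :
    tensorId γ Φ (M - N) = tensorId γ Φ M - tensorId γ Φ N := by
  ext i j
  exact congrFun₂ (map_sub Φ (Matrix.of fun a a' => M (a, i.2) (a', j.2))
    (Matrix.of fun a a' => N (a, i.2) (a', j.2))) i.1 j.1

theorem idTensor_sub (Φ : Op α →ₗ[ℂ] Op β) (M N : Op (γ × α)) :
    idTensor γ Φ (M - N) = idTensor γ Φ M - idTensor γ Φ N := by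
  ext i j
  exact congrFun₂ (map_sub Φ (Matrix.of fun a a' => M (i.1, a) (j.1, a'))
    (Matrix.of fun a a' => N (i.1, a) (j.1, a'))) i.2 j.2

theorem tensorId_link [Fintype η] (Φ : Op α →ₗ[ℂ] Op β) (C : Op (α × η)) (D : Op (η × γ)) :
    tensorId γ Φ (link C D) = link (tensorId η Φ C) D := by
  ext i j
  have slice : (Matrix.of fun a a' => link C D (a, i.2) (a', j.2)) =
      ∑ x, ∑ x', D (x, i.2) (x', j.2) • Matrix.of fun a a' => C (a, x) (a', x') := by
    ext a a'
    simp [link_apply, Matrix.sum_apply, mul_comm]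
  rw [tensorId, Matrix.of_apply, slice]
  simp only [map_sum, map_smul, Matrix.sum_apply, Matrix.smul_apply, smul_eq_mul, link_apply]
  exact Finset.sum_congr rfl fun x _ => Finset.sum_congr rfl fun x' _ =>
    mul_comm (D (x, i.2) (x', j.2)) _

theorem idTensor_link [Fintype η] (Φ : Op α →ₗ[ℂ] Op β) (C : Op (γ × η)) (D : Op (η × α)) :
    idTensor γ Φ (link C D) = link C (idTensor η Φ D) :=
  calc
    idTensor γ Φ (link C D)
      = (tensorId γ Φ ((link C D).submatrix Prod.swap Prod.swap)).submatrix Prod.swap Prod.swap :=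
      rfl
    _ = (link (tensorId η Φ (D.submatrix Prod.swap Prod.swap))
          (C.submatrix Prod.swap Prod.swap)).submatrix Prod.swap Prod.swap := by
      rw [link_swap, tensorId_link]
    _ = link C (idTensor η Φ D) := link_swap _ _

variable [Fintype α] [DecidableEq α] [Fintype β] {Φ : Op α →ₗ[ℂ] Op β}

theorem IsCPTP.trace_map (hΦ : IsCPTP Φ) (M : Op α) : (Φ M).trace = M.trace := by
  obtain ⟨m, E, hE, h⟩ := hΦ
  calc
    (Φ M).trace = ∑ k, ((E k)ᴴ * E k * M).trace := by
      simp only [h, trace_sum, fun k => trace_mul_cycle (E k) M (E k)ᴴ]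
    _ = M.trace := by rw [← trace_sum, ← Finset.sum_mul, hE, one_mul]

theorem IsCPTP.tensorId_posSemidef [Finite γ] (hΦ : IsCPTP Φ) {M : Op (α × γ)}
    (hM : M.PosSemidef) : (tensorId γ Φ M).PosSemidef := by
  classical
  cases nonempty_fintype γ
  obtain ⟨m, E, -, h⟩ := hΦ
  have kraus : tensorId γ Φ M = ∑ k, (E k ⊗ₖ (1 : Op γ)) * M * (E k ⊗ₖ (1 : Op γ))ᴴ := by
    ext i j
    simp only [tensorId, Matrix.of_apply, h, Matrix.sum_apply]
    refine Finset.sum_congr rfl fun k _ => ?_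
    simp [Matrix.mul_apply, Matrix.one_apply, Fintype.sum_prod_type, apply_ite]
  rw [kraus]
  exact posSemidef_sum _ fun k _ => hM.mul_mul_conjTranspose_same _

theorem IsCPTP.idTensor_posSemidef [Finite γ] (hΦ : IsCPTP Φ) {M : Op (γ × α)}
    (hM : M.PosSemidef) : (idTensor γ Φ M).PosSemidef :=
  (hΦ.tensorId_posSemidef (hM.submatrix Prod.swap)).submatrix Prod.swap

theorem IsCPTP.tensorId_mono [Finite γ] (hΦ : IsCPTP Φ) : Monotone (tensorId γ Φ) :=
  monotone_of_map_posSemidef (tensorId_sub Φ) fun _ => hΦ.tensorId_posSemidef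

theorem IsCPTP.idTensor_mono [Finite γ] (hΦ : IsCPTP Φ) : Monotone (idTensor γ Φ) :=
  monotone_of_map_posSemidef (idTensor_sub Φ) fun _ => hΦ.idTensor_posSemidef

theorem IsCPTP.traceLeft_tensorId (hΦ : IsCPTP Φ) (M : Op (α × γ)) :
    traceLeft (tensorId γ Φ M) = traceLeft M := by
  ext i j
  rw [traceLeft_apply, traceLeft_apply]
  exact hΦ.trace_map (Matrix.of fun a a' => M (a, i) (a', j))

theorem IsCPTP.trace_tensorId [Fintype γ] (hΦ : IsCPTP Φ) (M : Op (α × γ)) :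
    (tensorId γ Φ M).trace = M.trace := by
  rw [← trace_traceLeft, hΦ.traceLeft_tensorId, trace_traceLeft]

theorem IsCPTP.trace_idTensor [Fintype γ] (hΦ : IsCPTP Φ) (M : Op (γ × α)) :
    (idTensor γ Φ M).trace = M.trace :=
  calc
    (idTensor γ Φ M).trace = (tensorId γ Φ (M.submatrix Prod.swap Prod.swap)).trace :=
      trace_submatrix_equiv (tensorId γ Φ (M.submatrix Prod.swap Prod.swap)) (Equiv.prodComm γ β)
    _ = (M.submatrix Prod.swap Prod.swap).trace := hΦ.trace_tensorId _
    _ = M.trace := trace_submatrix_equiv M (Equiv.prodComm α γ)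

end Channels

section LinkDominated

variable {α β γ ξ ι : Type}

/-- The operators `S i` are dominated by `C i` linked with one common `D`. In a run of the protocol
`C i` describes Alice's actions given her classical input `i`, `D` describes Bob's actions, and the
shared factor `η` collects the messages exchanged so far. The constants are the trace of the `C i`,
a bound on their marginals on `η`, and the trace of `D`. -/
def LinkDominated [Fintype α] [Fintype β] (S : ι → Op (α × β)) (c₁ c₂ d : ℝ) : Prop :=
  ∃ (η : Type) (_ : Fintype η) (_ : DecidableEq η) (C : ι → Op (α × η)) (D : Op (η × β)),
    (∀ i, (C i).PosSemidef ∧ (C i).trace = c₁ ∧ traceLeft (C i) ≤ c₂ • 1) ∧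
      (D.PosSemidef ∧ D.trace = d) ∧ ∀ i, S i ≤ link (C i) D

namespace LinkDominated

variable [Fintype α] [Fintype β] [Fintype γ]

theorem of_le_kronecker {S : ι → Op (α × β)} {θ : ι → Op α} {σ : Op β} {d : ℝ}
    (hθ : ∀ i, IsDensity (θ i)) (hσ : σ.PosSemidef) (hd : σ.trace = d)
    (h : ∀ i, S i ≤ θ i ⊗ₖ σ) : LinkDominated S 1 1 d := by
  refine ⟨Unit, inferInstance, inferInstance, fun i => (θ i).submatrix Prod.fst Prod.fst,
    σ.submatrix Prod.snd Prod.snd, fun i => ⟨(hθ i).1.submatrix _, ?_, ?_⟩,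
    ⟨hσ.submatrix _, ?_⟩, fun i => (h i).trans_eq ?_⟩
  · rw [Complex.ofReal_one, ← (hθ i).2]
    exact trace_submatrix_equiv (θ i) (Equiv.prodPUnit α)
  · refine le_of_eq ?_
    ext
    simpa [traceLeft_apply, trace] using (hθ i).2
  · exact (trace_submatrix_equiv σ (Equiv.punitProd β)).trans hd
  · ext
    simp [link_apply]

theorem passRight [Fintype ξ] {S : ι → Op ((α × ξ) × β)} {c₁ c₂ d : ℝ}
    (h : LinkDominated S c₁ c₂ d) :
    LinkDominated (fun i => passRight (S i)) c₁ (Fintype.card ξ * c₂) (Fintype.card ξ * d) := by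
  classical
  obtain ⟨η, _, _, C, D, hC, ⟨hD, hDd⟩, hS⟩ := h
  refine ⟨η × ξ, inferInstance, inferInstance, fun i => QLeak.passRight (C i), share ξ D,
    fun i => ⟨(hC i).1.submatrix _, ?_, traceLeft_passRight_le (hC i).1 (hC i).2.2⟩,
    ⟨share_posSemidef hD, ?_⟩, fun i => ?_⟩
  · exact (trace_submatrix_equiv _ _).trans (hC i).2.1
  · rw [trace_share, hDd, Complex.ofReal_mul, Complex.ofReal_natCast]
  · rw [← passRight_link]
    exact submatrix_mono _ (hS i)

theorem passLeft [Fintype ξ] {S : ι → Op (α × (β × ξ))} {c₁ c₂ d : ℝ}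
    (h : LinkDominated S c₁ c₂ d) :
    LinkDominated (fun i => passLeft (S i)) (Fintype.card ξ * c₁) c₂ d := by
  classical
  obtain ⟨η, _, _, C, D, hC, ⟨hD, hDd⟩, hS⟩ := h
  refine ⟨η × ξ, inferInstance, inferInstance, fun i => share ξ (C i), QLeak.passLeft D,
    fun i => ⟨share_posSemidef (hC i).1, ?_, ?_⟩, ⟨hD.submatrix _, ?_⟩, fun i => ?_⟩
  · rw [trace_share, (hC i).2.1, Complex.ofReal_mul, Complex.ofReal_natCast]
  · rw [traceLeft_share, ← one_kronecker_one, ← smul_kronecker]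
    exact kronecker_mono_left PosSemidef.one (hC i).2.2
  · exact (trace_submatrix_equiv _ _).trans hDd
  · rw [← passLeft_link]
    exact submatrix_mono _ (hS i)

theorem tensorId [DecidableEq α] {S : ι → Op (α × β)} {c₁ c₂ d : ℝ}
    {G : ι → (Op α →ₗ[ℂ] Op γ)} (hG : ∀ i, IsCPTP (G i)) (h : LinkDominated S c₁ c₂ d) :
    LinkDominated (fun i => tensorId β (G i) (S i)) c₁ c₂ d := by
  obtain ⟨η, _, _, C, D, hC, hD, hS⟩ := h
  refine ⟨η, inferInstance, inferInstance, fun i => QLeak.tensorId η (G i) (C i), D,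
    fun i => ⟨(hG i).tensorId_posSemidef (hC i).1, ?_, ?_⟩, hD, fun i => ?_⟩
  · rw [(hG i).trace_tensorId, (hC i).2.1]
  · rw [(hG i).traceLeft_tensorId]
    exact (hC i).2.2
  · rw [← tensorId_link]
    exact (hG i).tensorId_mono (hS i)

theorem idTensor [DecidableEq β] {S : ι → Op (α × β)} {c₁ c₂ d : ℝ} {Ψ : Op β →ₗ[ℂ] Op γ}
    (hΨ : IsCPTP Ψ) (h : LinkDominated S c₁ c₂ d) :
    LinkDominated (fun i => idTensor α Ψ (S i)) c₁ c₂ d := by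
  obtain ⟨η, _, _, C, D, hC, ⟨hD, hDd⟩, hS⟩ := h
  refine ⟨η, inferInstance, inferInstance, C, QLeak.idTensor η Ψ D, hC,
    ⟨hΨ.idTensor_posSemidef hD, (hΨ.trace_idTensor D).trans hDd⟩, fun i => ?_⟩
  rw [← idTensor_link]
  exact hΨ.idTensor_mono (hS i)

theorem exists_traceLeft_le {S : ι → Op (α × β)} {c₁ c₂ d : ℝ} (h : LinkDominated S c₁ c₂ d)
    (hc₁ : 0 ≤ c₁) (hc₂ : 0 ≤ c₂) :
    ∃ E : Op β, E.PosSemidef ∧ E.trace = (min c₁ c₂ * d : ℝ) ∧ ∀ i, traceLeft (S i) ≤ E := by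
  obtain ⟨η, _, _, C, D, hC, ⟨hD, hDd⟩, hS⟩ := h
  have marginal_le (i : ι) : traceLeft (C i) ≤ min c₁ c₂ • 1 := by
    rcases min_choice c₁ c₂ with hmin | hmin <;> rw [hmin]
    · simpa only [trace_traceLeft, (hC i).2.1, Complex.ofReal_re]
        using le_trace_re_smul_one (traceLeft_posSemidef (hC i).1)
    · exact (hC i).2.2
  refine ⟨min c₁ c₂ • traceLeft D, (traceLeft_posSemidef hD).smul (le_min hc₁ hc₂), ?_,
    fun i => (traceLeft_mono (hS i)).trans (traceLeft_link_le (marginal_le i) hD)⟩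
  rw [trace_smul, trace_traceLeft, hDd, Complex.real_smul, Complex.ofReal_mul]

end LinkDominated

end LinkDominated

section Blocks

variable {α β γ δ ξ : Type} [DecidableEq α]

/-- The block diagonal operator `∑ₐ |a⟩⟨a| ⊗ Sᵃ`. -/
def blockOp [Fintype α] (S : α → Op β) : Op (α × β) :=
  ∑ a, ketbra a ⊗ₖ S a

/-- `blockOp` on a classical system and two further ones, with the brackets moved to the left. -/
def blockOpAssoc [Fintype α] (S : α → Op (β × γ)) : Op ((α × β) × γ) :=
  (blockOp S).submatrix (Equiv.prodAssoc α β γ) (Equiv.prodAssoc α β γ)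

theorem ketbra_posSemidef (a : α) : (ketbra a).PosSemidef := by
  rw [ketbra, ← diagonal_single]
  exact PosSemidef.diagonal (Pi.single_nonneg.2 zero_le_one)

variable [Fintype α]

theorem blockOp_apply (S : α → Op β) (i j : α × β) :
    blockOp S i j = if i.1 = j.1 then S i.1 i.2 j.2 else 0 := by
  simp [blockOp, Matrix.sum_apply, ketbra, single_apply, ite_and]

theorem blockOpAssoc_apply (S : α → Op (β × γ)) (i j : (α × β) × γ) :
    blockOpAssoc S i j =
      if i.1.1 = j.1.1 then S i.1.1 (i.1.2, i.2) (j.1.2, j.2) else 0 :=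
  blockOp_apply _ _ _

theorem cqOp_eq_blockOp (p : α → ℝ) (τ : α → Op β) : cqOp p τ = blockOp fun a => p a • τ a := by
  simp only [cqOp, blockOp, kronecker_smul]

theorem one_kronecker_eq_blockOp (T : Op β) : (1 : Op α) ⊗ₖ T = blockOp fun _ => T := by
  ext i j
  simp [blockOp_apply, Matrix.one_apply]

theorem sum_smul_ketbra (d : α → ℂ) : ∑ a, d a • ketbra a = diagonal d := by
  ext i j
  simp [ketbra, Matrix.sum_apply, single_apply, diagonal_apply, ite_and]

theorem blockOp_le_blockOp_iff [Finite β] {S T : α → Op β} :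
    blockOp S ≤ blockOp T ↔ ∀ a, S a ≤ T a := by
  refine ⟨fun h a => ?_, fun h =>
    Finset.sum_le_sum fun a _ => kronecker_mono_right (ketbra_posSemidef a) (h a)⟩
  have block (S : α → Op β) : (blockOp S).submatrix (Prod.mk a) (Prod.mk a) = S a := by
    ext
    simp [blockOp_apply]
  simpa only [block] using submatrix_mono (Prod.mk a) h

theorem blockOp_le_smul_one_kronecker_iff [Finite β] {S : α → Op β} {T : Op β} {t : ℝ} :
    blockOp S ≤ t • ((1 : Op α) ⊗ₖ T) ↔ ∀ a, S a ≤ t • T := by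
  rw [← kronecker_smul, one_kronecker_eq_blockOp, blockOp_le_blockOp_iff]

theorem traceMid_blockOpAssoc [Fintype β] (S : α → Op (β × γ)) :
    traceMid (blockOpAssoc S) = blockOp fun a => traceLeft (S a) := by
  ext i j
  simp only [traceMid, Matrix.of_apply, blockOpAssoc_apply, blockOp_apply, traceLeft_apply]
  split_ifs <;> simp

theorem idTensor_blockOpAssoc (Ψ : Op γ →ₗ[ℂ] Op δ) (S : α → Op (β × γ)) :
    idTensor (α × β) Ψ (blockOpAssoc S) = blockOpAssoc fun a => idTensor β Ψ (S a) := by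
  ext i j
  simp only [idTensor, Matrix.of_apply, blockOpAssoc_apply]
  split_ifs
  · rfl
  · exact congrFun₂ (map_zero Ψ) i.2 j.2

theorem reindex_handOver_blockOpAssoc (S : α → Op ((β × ξ) × γ)) :
    reindex (handOver α β ξ γ) (handOver α β ξ γ) (blockOpAssoc S) =
      blockOpAssoc fun a => passRight (S a) := by
  ext i j
  simp only [reindex_apply, submatrix_apply, blockOpAssoc_apply]
  rfl

theorem reindex_handOver_symm_blockOpAssoc (S : α → Op (β × (γ × ξ))) :
    reindex (handOver α β ξ γ).symm (handOver α β ξ γ).symm (blockOpAssoc S) =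
      blockOpAssoc fun a => passLeft (S a) := by
  ext i j
  simp only [reindex_apply, submatrix_apply, blockOpAssoc_apply]
  rfl

theorem tensorId_blockOpAssoc {Γ : Op (α × β) →ₗ[ℂ] Op (α × γ)} {G : α → (Op β →ₗ[ℂ] Op γ)}
    (h : ∀ S : α → Op β, Γ (blockOp S) = blockOp fun a => G a (S a)) (S : α → Op (β × δ)) :
    tensorId δ Γ (blockOpAssoc S) = blockOpAssoc fun a => tensorId δ (G a) (S a) := by
  ext i j
  have slice : (Matrix.of fun s s' => blockOpAssoc S (s, i.2) (s', j.2)) =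
      blockOp fun a => Matrix.of fun b b' => S a (b, i.2) (b', j.2) := by
    ext
    simp [blockOpAssoc_apply, blockOp_apply]
  rw [tensorId, Matrix.of_apply, slice, h, blockOp_apply, blockOpAssoc_apply]
  rfl

theorem tensorId_blockOp {Γ : Op α →ₗ[ℂ] Op (α × γ)} {τ : α → Op γ}
    (h : ∀ d : α → ℂ, Γ (diagonal d) = blockOp fun a => d a • τ a) (S : α → Op δ) :
    tensorId δ Γ (blockOp S) = blockOpAssoc fun a => τ a ⊗ₖ S a := by
  ext i j
  have slice : (Matrix.of fun a a' => blockOp S (a, i.2) (a', j.2)) =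
      diagonal fun a => S a i.2 j.2 := by
    ext
    simp [blockOp_apply, diagonal_apply]
  rw [tensorId, Matrix.of_apply, slice, h, blockOp_apply, blockOpAssoc_apply]
  simp [mul_comm]

end Blocks

section Controlled

variable {α β γ : Type}

open scoped Matrix.Norms.L2Operator in
theorem span_posSemidef [Finite β] : Submodule.span ℂ {M : Op β | M.PosSemidef} = ⊤ := by
  classical
  cases nonempty_fintype β
  simpa only [Matrix.nonneg_iff_posSemidef] using CStarAlgebra.span_nonneg (A := Op β)

theorem linearMap_ext_isDensity [Fintype β] {V : Type*} [AddCommGroup V] [Module ℂ V]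
    {f g : Op β →ₗ[ℂ] V} (h : ∀ ρ, IsDensity ρ → f ρ = g ρ) : f = g := by
  classical
  refine LinearMap.ext_on span_posSemidef fun M (hM : M.PosSemidef) => ?_
  by_cases h0 : M.trace = 0
  · rw [hM.trace_eq_zero_iff.1 h0, map_zero, map_zero]
  · have normalised : IsDensity (M.trace⁻¹ • M) :=
      ⟨hM.smul (inv_nonneg.2 hM.trace_nonneg), by rw [trace_smul, smul_eq_mul, inv_mul_cancel₀ h0]⟩
    have := h _ normalised
    rw [map_smul, map_smul] at this
    exact smul_right_injective V (inv_ne_zero h0) this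

variable [Fintype α] [DecidableEq α]

theorem isProb_single (a : α) : IsProb (Pi.single a (1 : ℝ)) :=
  ⟨fun b => by rw [Pi.single_apply]; split_ifs <;> norm_num, by simp⟩

theorem cqOp_single (a : α) (ρ : α → Op β) : cqOp (Pi.single a (1 : ℝ)) ρ = ketbra a ⊗ₖ ρ a := by
  simp [cqOp, Pi.single_apply]

variable [Fintype β]

theorem IsControlled.exists_map_blockOp [DecidableEq β] [Fintype γ]
    {Γ : Op (α × β) →ₗ[ℂ] Op (α × γ)} (hΓ : IsControlled Γ) :
    ∃ G : α → (Op β →ₗ[ℂ] Op γ), (∀ a, IsCPTP (G a)) ∧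
      ∀ S : α → Op β, Γ (blockOp S) = blockOp fun a => G a (S a) := by
  obtain ⟨-, G, hG, h⟩ := hΓ
  have on_block (a : α) : Γ ∘ₗ kroneckerBilinear (R := ℂ) (ketbra a) =
      kroneckerBilinear (R := ℂ) (ketbra a) ∘ₗ G a :=
    linearMap_ext_isDensity fun ρ hρ => by
      have := h (Pi.single a 1) (fun _ => ρ) (isProb_single a) fun _ => hρ
      rwa [cqOp_single, cqOp_single] at this
  refine ⟨G, hG, fun S => ?_⟩
  rw [blockOp, map_sum]
  exact Finset.sum_congr rfl fun a _ => LinearMap.congr_fun (on_block a) (S a)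

theorem IsControlledPrep.exists_map_diagonal {Γ : Op α →ₗ[ℂ] Op (α × β)}
    (hΓ : IsControlledPrep Γ) :
    ∃ τ : α → Op β, (∀ a, IsDensity (τ a)) ∧
      ∀ d : α → ℂ, Γ (diagonal d) = blockOp fun a => d a • τ a := by
  obtain ⟨-, τ, hτ, h⟩ := hΓ
  have on_ketbra (a : α) : Γ (ketbra a) = ketbra a ⊗ₖ τ a := by
    rw [← cqOp_single, ← h _ (isProb_single a)]
    simp [Pi.single_apply]
  refine ⟨τ, hτ, fun d => ?_⟩
  simp only [← sum_smul_ketbra, map_sum, map_smul, on_ketbra, blockOp, kronecker_smul]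

end Controlled

section Entropy

variable {α β γ : Type}

theorem IsCQState.trace_eq_one [Fintype α] [DecidableEq α] [Fintype β] {ρ : Op (α × β)}
    (hρ : IsCQState ρ) : ρ.trace = 1 := by
  obtain ⟨p, τ, hp, hτ, rfl⟩ := hρ
  simp only [cqOp, trace_sum, trace_smul, trace_kronecker, ketbra, trace_single_eq_same,
    (hτ _).2, mul_one, Complex.real_smul]
  exact_mod_cast hp.2

-- `E` is completed to trace `t` by a multiple of the maximally mixed state.
theorem exists_isDensity_le [Fintype β] [Nonempty β] {E : Op β} (hE : E.PosSemidef) {d t : ℝ}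
    (hd : E.trace = d) (ht : 0 < t) (hdt : d ≤ t) : ∃ ω : Op β, IsDensity ω ∧ E ≤ t • ω := by
  classical
  let s : ℝ := (t - d) / Fintype.card β
  have mixed : (s • (1 : Op β)).PosSemidef :=
    PosSemidef.one.smul (div_nonneg (sub_nonneg.2 hdt) (Nat.cast_nonneg _))
  refine ⟨t⁻¹ • (E + s • 1), ⟨(hE.add mixed).smul (inv_nonneg.2 ht.le), ?_⟩, ?_⟩
  · have : t⁻¹ * (d + s * Fintype.card β) = 1 := by
      simp only [s]
      field_simp
      ring
    rw [trace_smul, trace_add, trace_smul, hd, trace_one]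
    simp only [Complex.real_smul]
    exact_mod_cast this
  · rw [smul_inv_smul₀ ht.ne', Matrix.le_iff, add_sub_cancel_left]
    exact mixed

theorem LinkDominated.exists_isDensity_traceMid_le [Fintype α] [DecidableEq α] [Fintype β]
    [Nonempty β] [Fintype γ] {S : α → Op (γ × β)} {c₁ c₂ d t : ℝ} (h : LinkDominated S c₁ c₂ d)
    (hc₁ : 0 ≤ c₁) (hc₂ : 0 ≤ c₂) (ht : 0 < t) (hdt : min c₁ c₂ * d ≤ t) :
    ∃ ω : Op β, IsDensity ω ∧ traceMid (blockOpAssoc S) ≤ t • ((1 : Op α) ⊗ₖ ω) := by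
  obtain ⟨E, hE, hEd, hSE⟩ := h.exists_traceLeft_le hc₁ hc₂
  obtain ⟨ω, hω, hEω⟩ := exists_isDensity_le hE hEd ht hdt
  refine ⟨ω, hω, ?_⟩
  rw [traceMid_blockOpAssoc, blockOp_le_smul_one_kronecker_iff]
  exact fun a => (hSE a).trans hEω

theorem Hmin_sub_le_Hmin {α' β' : Type} [DecidableEq α] [Fintype β] [DecidableEq α'] [Fintype β']
    {ρ : Op (α × β)} {ρ' : Op (α' × β')} {m : ℝ}
    (h : ∀ (σ : Op β) (l : ℝ), IsDensity σ → ρ ≤ (2 : ℝ) ^ l • ((1 : Op α) ⊗ₖ σ) →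
      ∃ ω : Op β', IsDensity ω ∧ ρ' ≤ (2 : ℝ) ^ (l + m) • ((1 : Op α') ⊗ₖ ω)) :
    Hmin ρ - m ≤ Hmin ρ' := by
  have neg_Hmin_sub_le : -Hmin ρ' - m ≤ -Hmin ρ := by
    simp only [Hmin, neg_neg]
    refine le_iInf₂ fun σ hσ => le_iInf₂ fun l hl => ?_
    obtain ⟨ω, hω, hle⟩ := h σ l hσ hl
    rw [EReal.sub_le_iff_le_add (.inl (EReal.coe_ne_bot _)) (.inl (EReal.coe_ne_top _)),
      ← EReal.coe_add]
    exact iInf₂_le_of_le ω hω (iInf₂_le_of_le (l + m) hle le_rfl)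
  rw [← EReal.neg_le_neg_iff, EReal.neg_sub (.inr (EReal.coe_ne_bot _)) (.inr (EReal.coe_ne_top _))]
  exact (EReal.sub_le_iff_le_add (.inl (EReal.coe_ne_bot _)) (.inl (EReal.coe_ne_top _))).1
    neg_Hmin_sub_le

theorem prod_natCast_le_two_rpow_sum_logb {ι : Type*} (s : Finset ι) (c : ι → ℕ) :
    ∏ k ∈ s, (c k : ℝ) ≤ 2 ^ ∑ k ∈ s, Real.logb 2 (c k) := by
  rw [Real.rpow_sum_of_pos two_pos]
  refine Finset.prod_le_prod (fun _ _ => Nat.cast_nonneg _) fun k _ => ?_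
  rcases (c k).eq_zero_or_pos with h | h
  · simp [h]
  · rw [Real.rpow_logb two_pos (by norm_num) (by exact_mod_cast h)]

end Entropy

namespace Protocol

variable {A₀ : Type} [Fintype A₀] [DecidableEq A₀] {n : ℕ} (P : Protocol A₀ n)

/-- The joint dimension of Alice's first `k` messages. -/
def dimX (k : ℕ) : ℝ := ∏ j ∈ Finset.range k, (Fintype.card (P.X j) : ℝ)

/-- The joint dimension of Bob's first `k` messages. -/
def dimY (k : ℕ) : ℝ := ∏ j ∈ Finset.range k, (Fintype.card (P.Y j) : ℝ)

theorem dimX_nonneg (k : ℕ) : 0 ≤ P.dimX k :=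
  Finset.prod_nonneg fun _ _ => Nat.cast_nonneg _

theorem dimY_nonneg (k : ℕ) : 0 ≤ P.dimY k :=
  Finset.prod_nonneg fun _ _ => Nat.cast_nonneg _

theorem dimX_succ (k : ℕ) : P.dimX (k + 1) = Fintype.card (P.X k) * P.dimX k := by
  rw [dimX, Finset.prod_range_succ, mul_comm, ← dimX]

theorem dimY_succ (k : ℕ) : P.dimY (k + 1) = Fintype.card (P.Y k) * P.dimY k := by
  rw [dimY, Finset.prod_range_succ, mul_comm, ← dimY]

theorem min_dim_mul_dimX_le :
    min (P.dimY n) (P.dimX (n + 1)) * P.dimX (n + 1) ≤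
      2 ^ min (P.mA + P.mB) (2 * P.mA) := by
  have hX : P.dimX (n + 1) ≤ 2 ^ P.mA := prod_natCast_le_two_rpow_sum_logb _ _
  have hY : P.dimY n ≤ 2 ^ P.mB := prod_natCast_le_two_rpow_sum_logb _ _
  calc
    min (P.dimY n) (P.dimX (n + 1)) * P.dimX (n + 1)
      ≤ min (2 ^ P.mB) (2 ^ P.mA) * 2 ^ P.mA :=
      mul_le_mul (min_le_min hY hX) hX (P.dimX_nonneg _) (by positivity)
    _ = 2 ^ min (P.mA + P.mB) (2 * P.mA) := by
      rw [two_mul, min_add_add_left, add_comm, Real.rpow_add two_pos,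
        (Real.monotone_rpow_of_base_ge_one one_le_two).map_min]

variable {P}

theorem trace_stateAfter (ρ : Op (A₀ × P.B 0)) :
    ∀ k ≤ n, (P.stateAfter ρ k).trace = ρ.trace
  | 0, _ => P.controlled_Φ₁.1.trace_tensorId ρ
  | k + 1, hk => by
    rw [stateAfter, (P.controlled_Φ k hk).1.trace_tensorId, reindex_apply, trace_submatrix_equiv,
      (P.cptp_Ψ k hk).trace_idTensor, reindex_apply, trace_submatrix_equiv,
      trace_stateAfter ρ k (Nat.le_of_succ_le hk)]

theorem trace_finalState (ρ : Op (A₀ × P.B 0)) : (P.finalState ρ).trace = ρ.trace := by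
  rw [finalState, P.cptp_Ψlast.trace_idTensor, reindex_apply, trace_submatrix_equiv,
    trace_stateAfter ρ n le_rfl]

theorem nonempty_Bout {ρ : Op (A₀ × P.B 0)} (hρ : IsCQState ρ) : Nonempty P.Bout := by
  by_contra h
  rw [not_nonempty_iff] at h
  have : (P.finalState ρ).trace = 1 := (trace_finalState ρ).trans hρ.trace_eq_one
  simp [trace] at this

variable {S₀ : A₀ → Op (P.B 0)} {σ : Op (P.B 0)} {d : ℝ}

theorem exists_blocks_stateAfter (hσ : σ.PosSemidef) (hd : σ.trace = d) (h : ∀ a, S₀ a ≤ σ) :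
    ∀ k ≤ n, ∃ S : A₀ → Op ((P.A k × P.X k) × P.B k),
      P.stateAfter (blockOp S₀) k = blockOpAssoc S ∧
        LinkDominated S (P.dimY k) (P.dimX k) (P.dimX k * d)
  | 0, _ => by
    obtain ⟨θ, hθ, hΦ⟩ := P.controlled_Φ₁.exists_map_diagonal
    refine ⟨fun a => θ a ⊗ₖ S₀ a, tensorId_blockOp hΦ S₀, ?_⟩
    simpa [dimX, dimY] using LinkDominated.of_le_kronecker hθ hσ hd
      fun a => kronecker_mono_right (hθ a).1 (h a)
  | k + 1, hk => by
    obtain ⟨S, hS, hdom⟩ := exists_blocks_stateAfter hσ hd h k (Nat.le_of_succ_le hk)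
    obtain ⟨G, hG, hΦ⟩ := (P.controlled_Φ k hk).exists_map_blockOp
    refine ⟨fun a => tensorId _ (G a) (passLeft (idTensor _ (P.Ψ k) (passRight (S a)))), ?_, ?_⟩
    · rw [stateAfter, hS, reindex_handOver_blockOpAssoc, idTensor_blockOpAssoc,
        reindex_handOver_symm_blockOpAssoc, tensorId_blockOpAssoc hΦ]
    · rw [dimX_succ, dimY_succ, mul_assoc]
      exact ((hdom.passRight.idTensor (P.cptp_Ψ k hk)).passLeft).tensorId hG

theorem exists_blocks_finalState (hσ : σ.PosSemidef) (hd : σ.trace = d) (h : ∀ a, S₀ a ≤ σ) :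
    ∃ S : A₀ → Op (P.A n × P.Bout), P.finalState (blockOp S₀) = blockOpAssoc S ∧
      LinkDominated S (P.dimY n) (P.dimX (n + 1)) (P.dimX (n + 1) * d) := by
  obtain ⟨S, hS, hdom⟩ := exists_blocks_stateAfter hσ hd h n le_rfl
  refine ⟨fun a => idTensor _ P.Ψlast (passRight (S a)), ?_, ?_⟩
  · rw [finalState, hS, reindex_handOver_blockOpAssoc, idTensor_blockOpAssoc]
  · rw [dimX_succ, mul_assoc]
    exact hdom.passRight.idTensor P.cptp_Ψlast

end Protocol

end QLeak

end

theorem mainTheorem1 {A₀ : Type} [Fintype A₀] [DecidableEq A₀] (n : ℕ)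
    (P : QLeak.Protocol A₀ n) (ρ : QLeak.Op (A₀ × P.B 0)) (hρ : QLeak.IsCQState ρ) :
    QLeak.Hmin (QLeak.traceMid (P.finalState ρ)) ≥
      QLeak.Hmin ρ - ((min (P.mA + P.mB) (2 * P.mA) : ℝ) : EReal) := by
  open QLeak QLeak.Protocol in
  have : Nonempty P.Bout := nonempty_Bout hρ
  obtain ⟨p, τ, -, -, rfl⟩ := hρ
  refine Hmin_sub_le_Hmin fun σ l hσ hl => ?_
  rw [cqOp_eq_blockOp] at hl ⊢
  have hblocks := blockOp_le_smul_one_kronecker_iff.1 hl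
  have hl₀ : (0 : ℝ) < 2 ^ l := Real.rpow_pos_of_pos two_pos l
  have htrace : ((2 : ℝ) ^ l • σ).trace = ((2 ^ l : ℝ) : ℂ) := by simp [hσ.2]
  obtain ⟨S, hS, hdom⟩ := exists_blocks_finalState (hσ.1.smul hl₀.le) htrace hblocks
  rw [hS]
  refine hdom.exists_isDensity_traceMid_le (P.dimY_nonneg n) (P.dimX_nonneg _) (by positivity) ?_
  rw [Real.rpow_add two_pos, ← mul_assoc, mul_comm (2 ^ l : ℝ)]
  gcongr
  exact P.min_dim_mul_dimX_le
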